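/- **Setting.** Let $E$ be a vector space of finite dimension $n$ over the finite field $\mathbb F_q$, and fix an involutive anti-isomorphism $U\mapsto U^\perp$ of its lattice of subspaces (and one for each quotient $E/T$). Let $M=(E,\rho)$ be a $(q,r)$-polymatroid: $\rho$ assigns to every subspace of $E$ a non-negative integer with $\rho(A)\le r\dim A$, $\rho(A)\le\rho(B)$ for $A\le B$, and $\rho(A+B)+\rho(A\cap B)\le\rho(A)+\rho(B)$. Its dual is $M^*=(E,\rho^*)$ with $\rho^*(A)=r\dim A-\rho(E)+\rho(A^\perp)$. For $T\le E$ the contraction $M/T$ is the $(q,r)$-polymatroid on $E/T$ with $\rho_{M/T}(A/T)=\rho(A)-\rho(T)$, and $M.X:=M/X^\perp$. A cocircuit of $M$ is a minimal subspace $C$ with $\rho^*(C)\neq r\dim C$, and $d_M$ is the least dimension of a cocircuit. The characteristic polynomial is $p(M;z)=\sum_{X\le E}\mu(0,X)\,z^{\rho(E)-\rho(X)}\in\mathbb Z[z]$, with $\mu$ the Möbius function of the lattice of subspaces of the ground space, and $A_M(i;z)=\sum_{\dim X=i}p(M.X;z)$; the same notation is used for $q$-polymatroids on other ground spaces. Let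 $\mathbb F$ be a field and $\theta\in\mathbb F$ with $\theta^s\ne1$ for all $s\in\{1,\dots,r\}$. For integers $t,i$ put $R_M(t;\theta)=\{j\in\{1,\dots,n-t\}:A_{M^*}(j;\theta)\neq0\}$ and $D_M(i;\theta)=\{X\le E:\dim X=i,\ p(M.X;\theta)\ne0\}$. For positive integers $t,k$, a triple $(E,\mathcal B,f)$ with $\mathcal B$ a set of $k$-dimensional subspaces of $E$ and $f:\mathcal B\to\mathbb F$ is a weighted $t$-design over $\mathbb F_q$ if there is $\lambda\in\mathbb F$ with $\sum_{B\in\mathcal B,\,T\le B}f(B)=\lambda$ for every $t$-dimensional subspace $T$ of $E$. **Statement.** Let $t$ be a positive integer with $t<d_M$. Assume that $q$ and the integers $1+q+\dots+q^{i-1}$, $1\le i\le n-t$, are nonzero in $\mathbb F$ (as is automatic in characteristic $0$). Suppose that $|R_M(t;\theta)|\le d_M-t$, and that for every $t$-dimensional subspace $T$ of $E$ and every $j\le n-t$, $A_{M^*}(j;\theta)=0$ implies $A_{M^*/T}(j;\theta)=0$. Then for each $j\in\{d_M,\dots,n-t\}$, $(E,D_M(j;\theta),f)$ with $f(X)=p(M.X;\theta)$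 is a weighted $t$-design over $\mathbb F_q$. -/

import Mathlib

namespace QPoly

noncomputable section

open Module
open scoped Classical

/-- A `(q,r)`-polymatroid on the `K`-vector space `V` (with `q = |K|`): an integer-valued rank
function on the lattice of subspaces with (R1) boundedness, (R2) monotonicity, (R3) semimodularity. -/
structure QPolymatroid (K V : Type*) [Field K] [AddCommGroup V] [Module K V] (r : ℕ) where
  rank : Submodule K V → ℕ
  rank_le : ∀ A, rank A ≤ r * finrank K A
  mono : ∀ A B, A ≤ B → rank A ≤ rank B
  semimod : ∀ A B, rank (A ⊔ B) + rank (A ⊓ B) ≤ rank A + rank B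

/-- An involutive anti-isomorphism `U ↦ U^⊥` of the lattice of subspaces of `V`
(an order-reversing involution is automatically bijective and interchanges sums and
intersections). -/
structure Perp (K V : Type*) [Field K] [AddCommGroup V] [Module K V] where
  map : Submodule K V → Submodule K V
  antitone : ∀ U W, U ≤ W → map W ≤ map U
  invol : ∀ U, map (map U) = U

section Instances

variable (K V : Type*) [Field K] [Finite K] [AddCommGroup V] [Module K V] [FiniteDimensional K V]

instance finiteSubmodule : Finite (Submodule K V) :=
  have : Finite V := Module.finite_of_finite K
  Finite.of_injective (fun U : Submodule K V => (U : Set V)) SetLike.coe_injective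

instance fintypeSubmodule : Fintype (Submodule K V) := Fintype.ofFinite _

instance locallyFiniteSubmodule : LocallyFiniteOrder (Submodule K V) :=
  Fintype.toLocallyFiniteOrder

end Instances

section Perp

variable {K V : Type*} [Field K] [AddCommGroup V] [Module K V]

theorem Perp.lt (p : Perp K V) {U W : Submodule K V} (h : U < W) : p.map W < p.map U := by
  refine lt_of_le_of_ne (p.antitone _ _ h.le) fun e => h.ne ?_
  rw [← p.invol U, ← p.invol W, e]

theorem Perp.map_sup (p : Perp K V) (U W : Submodule K V) :
    p.map (U ⊔ W) = p.map U ⊓ p.map W := by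
  apply le_antisymm
  · exact le_inf (p.antitone _ _ le_sup_left) (p.antitone _ _ le_sup_right)
  · rw [← p.invol (p.map U ⊓ p.map W)]
    apply p.antitone
    refine sup_le ?_ ?_
    · conv_lhs => rw [← p.invol U]
      exact p.antitone _ _ inf_le_left
    · conv_lhs => rw [← p.invol W]
      exact p.antitone _ _ inf_le_right

theorem Perp.map_inf (p : Perp K V) (U W : Submodule K V) :
    p.map (U ⊓ W) = p.map U ⊔ p.map W := by
  rw [← p.invol (p.map U ⊔ p.map W), p.map_sup, p.invol, p.invol]

variable [FiniteDimensional K V]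

theorem Perp.finrank_map (p : Perp K V) (U : Submodule K V) :
    finrank K (p.map U) + finrank K U = finrank K V := by
  have upper : ∀ m, ∀ W : Submodule K V, finrank K W = m →
      finrank K (p.map W) + m ≤ finrank K V := by
    intro m
    induction m with
    | zero => intro W _; simpa using Submodule.finrank_le (p.map W)
    | succ m ih =>
      intro W hW
      obtain ⟨W', hW', hm⟩ : ∃ W' : Submodule K V, W' < W ∧ finrank K W' = m := by
        obtain ⟨f, hf⟩ := (finrank_pos_iff_exists_ne_zero (R := K) (M := W)).1 (by omega)
        obtain ⟨C, hC⟩ := Submodule.exists_isCompl (K ∙ f)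
        have h1 := Submodule.finrank_add_eq_of_isCompl hC
        rw [finrank_span_singleton hf, hW] at h1
        have h2 : finrank K (C.map W.subtype) = finrank K C :=
          Submodule.finrank_map_subtype_eq W C
        refine ⟨C.map W.subtype, lt_of_le_of_ne (Submodule.map_subtype_le W C) ?_, by omega⟩
        intro e
        rw [e] at h2
        omega
      have h1 := Submodule.finrank_lt_finrank_of_lt (p.lt hW')
      have h2 := ih W' hm
      omega
  have lower : ∀ m, ∀ W : Submodule K V, finrank K W + m = finrank K V →
      m ≤ finrank K (p.map W) := by
    intro m
    induction m with
    | zero => intro W _; exact Nat.zero_le _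
    | succ m ih =>
      intro W hW
      have hne : W ≠ ⊤ := by
        rintro rfl
        rw [finrank_top] at hW
        omega
      obtain ⟨x, hx⟩ : ∃ x, x ∉ W := by
        by_contra! h
        exact hne (Submodule.eq_top_iff'.2 h)
      have hlt : W < W ⊔ (K ∙ x) := by
        refine lt_of_le_of_ne le_sup_left fun e => hx ?_
        rw [e]
        exact Submodule.mem_sup_right (Submodule.mem_span_singleton_self x)
      have h1 := Submodule.finrank_lt_finrank_of_lt hlt
      have h2 := Submodule.finrank_add_le_finrank_add_finrank W (K ∙ x)
      have h3 := finrank_span_le_card (R := K) ({x} : Set V)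
      have h4 := ih (W ⊔ (K ∙ x)) (by simp at h3; omega)
      have h5 := Submodule.finrank_lt_finrank_of_lt (p.lt hlt)
      omega
  have h1 := upper _ U rfl
  have h2 := lower (finrank K V - finrank K U) U (by have := Submodule.finrank_le U; omega)
  have := Submodule.finrank_le U
  omega

end Perp

namespace QPolymatroid

section Basic

variable {K V : Type*} [Field K] [AddCommGroup V] [Module K V] {r : ℕ}

/-- `ρ(A) ≤ ρ(T) + r (dim A - dim T)` for `T ≤ A`. -/
theorem rank_le_add [FiniteDimensional K V] (M : QPolymatroid K V r) {T A : Submodule K V}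
    (h : T ≤ A) : M.rank A + r * finrank K T ≤ M.rank T + r * finrank K A := by
  obtain ⟨C, hC⟩ := Submodule.exists_isCompl T
  have hs : T ⊔ (C ⊓ A) = A := by
    rw [← sup_inf_assoc_of_le C h, hC.sup_eq_top, top_inf_eq]
  have hi : T ⊓ (C ⊓ A) = ⊥ := by
    rw [← inf_assoc, hC.inf_eq_bot, bot_inf_eq]
  have h1 := M.semimod T (C ⊓ A)
  have h2 := M.rank_le (C ⊓ A)
  have h3 := Submodule.finrank_sup_add_finrank_inf_eq T (C ⊓ A)
  rw [hs, hi] at h1 h3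
  rw [finrank_bot] at h3
  have h4 : r * finrank K A = r * finrank K T + r * finrank K (C ⊓ A : Submodule K V) := by
    rw [← mul_add]; congr 1
  omega

/-- The dual `M^*`, with rank function `ρ^*(A) = r dim A - ρ(E) + ρ(A^⊥)`. -/
def dual [FiniteDimensional K V] (M : QPolymatroid K V r) (p : Perp K V) :
    QPolymatroid K V r where
  rank A := r * finrank K A + M.rank (p.map A) - M.rank ⊤
  rank_le A := by
    have := M.mono (p.map A) ⊤ le_top
    omega
  mono A B h := by
    have h1 := M.rank_le_add (p.antitone A B h)
    have e : r * finrank K (p.map A) + r * finrank K A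
        = r * finrank K (p.map B) + r * finrank K B := by
      rw [← mul_add, ← mul_add, p.finrank_map, p.finrank_map]
    omega
  semimod A B := by
    have h1 := M.semimod (p.map A) (p.map B)
    rw [← p.map_sup, ← p.map_inf] at h1
    have h2 := Submodule.finrank_sup_add_finrank_inf_eq A B
    have h3 : r * finrank K (A ⊔ B : Submodule K V) + r * finrank K (A ⊓ B : Submodule K V)
        = r * finrank K A + r * finrank K B := by
      rw [← mul_add, ← mul_add, h2]
    have key : ∀ C : Submodule K V, M.rank ⊤ ≤ r * finrank K C + M.rank (p.map C) := by
      intro C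
      have h4 := M.rank_le_add (le_top : p.map C ≤ ⊤)
      rw [finrank_top, ← p.finrank_map C, mul_add] at h4
      omega
    have k1 := key (A ⊔ B)
    have k2 := key (A ⊓ B)
    omega

/-- The contraction `M/T` on the quotient space `V/T`; subspaces of `V/T` are `A/T` with
`T ≤ A`, and `ρ_{M/T}(A/T) = ρ(A) - ρ(T)`. -/
def contract [FiniteDimensional K V] (M : QPolymatroid K V r) (T : Submodule K V) :
    QPolymatroid K (V ⧸ T) r where
  rank B := M.rank (B.comap T.mkQ) - M.rank T
  rank_le B := by
    have hT : T ≤ B.comap T.mkQ := T.le_comap_mkQ B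
    have h1 := M.rank_le_add hT
    have h2 : finrank K (B.comap T.mkQ) = finrank K T + finrank K B := by
      have e := LinearMap.finrank_range_add_finrank_ker (T.mkQ.domRestrict (B.comap T.mkQ))
      rw [LinearMap.range_domRestrict, Submodule.map_comap_eq_of_surjective T.mkQ_surjective,
        LinearMap.ker_domRestrict, Submodule.ker_mkQ,
        (Submodule.comapSubtypeEquivOfLe hT).finrank_eq] at e
      omega
    rw [h2, mul_add] at h1
    omega
  mono A B h := Nat.sub_le_sub_right (M.mono _ _ (Submodule.comap_mono h)) _
  semimod A B := by
    have h1 := M.semimod (A.comap T.mkQ) (B.comap T.mkQ)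
    have hs : A.comap T.mkQ ⊔ B.comap T.mkQ = (A ⊔ B).comap T.mkQ := by
      apply le_antisymm
      · exact sup_le (Submodule.comap_mono le_sup_left) (Submodule.comap_mono le_sup_right)
      · intro x hx
        obtain ⟨a, ha, b, hb, hab⟩ := Submodule.mem_sup.1 (Submodule.mem_comap.1 hx)
        obtain ⟨a', rfl⟩ := T.mkQ_surjective a
        have : x - a' ∈ B.comap T.mkQ := by
          rw [Submodule.mem_comap, map_sub, ← hab, add_sub_cancel_left]
          exact hb
        have h2 := Submodule.add_mem_sup (S := A.comap T.mkQ) (Submodule.mem_comap.2 ha) this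
        rwa [add_sub_cancel] at h2
    rw [hs, ← Submodule.comap_inf] at h1
    have k1 := M.mono _ _ (T.le_comap_mkQ (A ⊔ B))
    have k2 := M.mono _ _ (T.le_comap_mkQ (A ⊓ B))
    omega

/-- `M.X := M / X^⊥`, the contraction of `M` to `X`. -/
def contractTo [FiniteDimensional K V] (M : QPolymatroid K V r) (p : Perp K V)
    (X : Submodule K V) : QPolymatroid K (V ⧸ p.map X) r :=
  M.contract (p.map X)

/-- `I` is independent if `ρ(I) = r dim I`. -/
def Indep (M : QPolymatroid K V r) (I : Submodule K V) : Prop :=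
  M.rank I = r * finrank K I

/-- A circuit is an inclusion-minimal dependent space. -/
def IsCircuit (M : QPolymatroid K V r) (C : Submodule K V) : Prop :=
  Minimal (fun A => ¬ M.Indep A) C

/-- A cocircuit of `M` is a circuit of `M^*`. -/
def IsCocircuit [FiniteDimensional K V] (M : QPolymatroid K V r) (p : Perp K V)
    (C : Submodule K V) : Prop :=
  (M.dual p).IsCircuit C

/-- `d_M`, the least dimension of a cocircuit of `M` (with value `0` if there is none). -/
def minCocircuitDim [FiniteDimensional K V] (M : QPolymatroid K V r) (p : Perp K V) : ℕ :=
  sInf {d | ∃ C : Submodule K V, M.IsCocircuit p C ∧ finrank K C = d}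

/-- `ℓ_M(A) = ρ(E) - ρ(A)`. -/
def ell (M : QPolymatroid K V r) (A : Submodule K V) : ℕ := M.rank ⊤ - M.rank A

end Basic

section Finite

variable {K V : Type*} [Field K] [Finite K] [AddCommGroup V] [Module K V]
  [FiniteDimensional K V] {r : ℕ}

/-- The characteristic polynomial `p(M;z) = ∑_{X ≤ E} μ(0,X) z^{ℓ(X)}`, where `μ` is the Möbius
function of the lattice of subspaces. -/
def charPoly (M : QPolymatroid K V r) : Polynomial ℤ :=
  ∑ X : Submodule K V,
    Polynomial.C (IncidenceAlgebra.mu ℤ (⊥ : Submodule K V) X) * Polynomial.X ^ M.ell X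

/-- The weight enumerator `A_M(i;z) = ∑_{dim X = i} p(M.X;z)`. -/
def weightEnum (M : QPolymatroid K V r) (p : Perp K V) (i : ℕ) : Polynomial ℤ :=
  ∑ X ∈ Finset.univ.filter (fun X : Submodule K V => finrank K X = i),
    (M.contractTo p X).charPoly

variable {F : Type*} [Field F]

/-- The value `p(M.X;θ)`. -/
def weight (M : QPolymatroid K V r) (p : Perp K V) (θ : F) (X : Submodule K V) : F :=
  Polynomial.aeval θ (M.contractTo p X).charPoly

/-- `D_M(i;θ)`, the set of `i`-dimensional subspaces `X` with `p(M.X;θ) ≠ 0`. -/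
def blocks (M : QPolymatroid K V r) (p : Perp K V) (i : ℕ) (θ : F) : Set (Submodule K V) :=
  {X | finrank K X = i ∧ M.weight p θ X ≠ 0}

/-- `R_M(t;θ)`, the set of `j ∈ {1,…,n-t}` with `A_{M^*}(j;θ) ≠ 0`. -/
def dualWeights (M : QPolymatroid K V r) (p : Perp K V) (t : ℕ) (θ : F) : Finset ℕ :=
  {j ∈ Finset.Icc 1 (finrank K V - t) | Polynomial.aeval θ ((M.dual p).weightEnum p j) ≠ 0}

end Finite

end QPolymatroid

/-- `(V, B, f)` is a weighted `t`-`(n,k,λ;q)` design with weights in the additive group `G`: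
`t` and `k` are positive, `B` is a collection of `k`-dimensional subspaces of `V`, and for every
`t`-dimensional subspace `T` the sum of `f` over the blocks that contain `T` equals `lam`. -/
structure IsWeightedDesign {K V G : Type*} [Field K] [Finite K] [AddCommGroup V] [Module K V]
    [FiniteDimensional K V] [AddCommGroup G] (t k : ℕ) (lam : G)
    (B : Set (Submodule K V)) (f : B → G) : Prop where
  t_pos : 0 < t
  k_pos : 0 < k
  finrank_block : ∀ X ∈ B, finrank K X = k
  sum_eq : ∀ T : Submodule K V, finrank K T = t →
    ∑ X ∈ Finset.univ.filter (fun X : B => T ≤ (X : Submodule K V)), f X = lam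

end

end QPoly

/-!
Let `σ` be the rank function of `M^*`, `d = d_M`, `n = dim E` and `m = n - t`. A space is dependent in
`M^*` only if its dimension is at least `d`. By Möbius inversion the weights `f(X) = p(M.X;θ)` satisfy
`∑_{X ≤ A} f(X) = θ^(r dim A - σ(A))` (`QPolymatroid.sum_weight_le`, `QPolymatroid.ell_map_perp`), so
`f` vanishes in the dimensions `1, …, d - 1`.

For a `t`-dimensional `T`, counting subspaces expresses `∑ θ^(σ(E) - σ(A))`, over the `A ≥ T` with
`dim A = t + u`, as `∑_j A_{M^*/T}(j;θ) [m - j choose u]_q` (`QPolymatroid.sum_ge_pow_ell`). For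
`u < d - t` these sums are the same for all `T`, because the spaces `A` are independent, and at most
`d - t` of the unknowns `A_{M^*/T}(j;θ)`, `j ≥ 1`, are nonzero. A Vandermonde argument in the points
`[m - j]_q`, distinct by the assumption on the `q`-integers, shows that the unknowns do not depend on
`T`; hence neither do the sums, for every `u` (`QPolymatroid.sum_ge_pow_ell_eq`).

In each dimension `θ^(r dim A - σ(A))` is an affine function of `θ^(σ(E) - σ(A))`
(`QPolymatroid.exists_pow_sub_rank_eq`). For `θ ≠ 0` this is immediate. For `θ = 0` it needs
`σ(E) ≤ r d`, which the same linear system yields: otherwise its first `d - t + 1` right-hand sides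
vanish, and so does every unknown, although `A_{M^*/T}(0;θ) = 1`
(`QPolymatroid.rank_top_le_of_card_le`).

Thus `∑_{A ≥ T, dim A = i} ∑_{X ≤ A} f(X)` does not depend on `T`, and by unitriangularity neither
does `∑_{dim (X + T) = l} f(X)`. As in the theorem of Assmus and Mattson, induction on the dimension
now gives the designs: among the `X` with `dim (X + T) = j`, those of dimension `j` are the ones that
contain `T`, and the smaller ones contribute intersection numbers of designs already found
(`sum_ge_eq_of_sum_finrank_sup_eq`).
-/

namespace QPoly

noncomputable section

open Module Finset
open scoped Classical

set_option linter.unusedSectionVars false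

/-! ### Counting subspaces -/

section Counting

variable {K V : Type*} [Field K] [Finite K] [AddCommGroup V] [Module K V] [FiniteDimensional K V]

/-- The Gaussian binomial coefficient `[c choose u]_q` with `q = |K|`, encoded as the number of
`u`-dimensional subspaces of `K^c`. -/
def gaussBinom (K : Type*) [Field K] [Finite K] (c u : ℕ) : ℕ :=
  #{W : Submodule K (Fin c → K) | finrank K W = u}

theorem card_finrank_eq (u : ℕ) :
    #{W : Submodule K V | finrank K W = u} = gaussBinom K (finrank K V) u := by
  let e : V ≃ₗ[K] (Fin (finrank K V) → K) := LinearEquiv.ofFinrankEq _ _ (by simp)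
  refine Finset.card_equiv (Submodule.orderIsoMapComap e).toEquiv fun W => ?_
  simp only [mem_filter, mem_univ, true_and]
  exact Eq.congr_left (LinearEquiv.finrank_map_eq e W).symm

theorem finrank_comap_mkQ (T : Submodule K V) (W : Submodule K (V ⧸ T)) :
    finrank K (W.comap T.mkQ) = finrank K T + finrank K W := by
  have hT : T ≤ W.comap T.mkQ := T.le_comap_mkQ W
  have e := LinearMap.finrank_range_add_finrank_ker (T.mkQ.domRestrict (W.comap T.mkQ))
  rw [LinearMap.range_domRestrict, Submodule.map_comap_eq_of_surjective T.mkQ_surjective,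
    LinearMap.ker_domRestrict, Submodule.ker_mkQ,
    (Submodule.comapSubtypeEquivOfLe hT).finrank_eq] at e
  omega

theorem sum_comap_mkQ {R : Type*} [AddCommMonoid R] (T : Submodule K V) (P : Submodule K V → Prop)
    [DecidablePred P] (g : Submodule K V → R) :
    ∑ W : Submodule K (V ⧸ T) with P (W.comap T.mkQ), g (W.comap T.mkQ) =
      ∑ A : Submodule K V with T ≤ A ∧ P A, g A := by
  have key : ∀ A : Submodule K V, T ≤ A → (A.map T.mkQ).comap T.mkQ = A := fun A hA => by
    rw [Submodule.comap_map_mkQ, sup_eq_right.2 hA]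
  refine Finset.sum_nbij' (fun W => W.comap T.mkQ) (fun A => A.map T.mkQ) ?_ ?_ ?_ ?_ ?_
  · intro W hW
    simp only [mem_filter, mem_univ, true_and] at hW ⊢
    exact ⟨T.le_comap_mkQ W, hW⟩
  · intro A hA
    simp only [mem_filter, mem_univ, true_and] at hA ⊢
    rw [key A hA.1]
    exact hA.2
  · intro W _
    exact Submodule.map_comap_eq_of_surjective T.mkQ_surjective W
  · intro A hA
    exact key A (mem_filter.1 hA).2.1
  · intros; rfl

theorem sum_map_subtype {R : Type*} [AddCommMonoid R] (Y : Submodule K V)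
    (P : Submodule K V → Prop) [DecidablePred P] (g : Submodule K V → R) :
    ∑ W : Submodule K Y with P (W.map Y.subtype), g (W.map Y.subtype) =
      ∑ A : Submodule K V with A ≤ Y ∧ P A, g A := by
  have key : ∀ A : Submodule K V, A ≤ Y → (A.comap Y.subtype).map Y.subtype = A := fun A hA => by
    rw [Submodule.map_comap_subtype, inf_eq_right.2 hA]
  refine Finset.sum_nbij' (fun W => W.map Y.subtype) (fun A => A.comap Y.subtype) ?_ ?_ ?_ ?_ ?_
  · intro W hW
    simp only [mem_filter, mem_univ, true_and] at hW ⊢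
    exact ⟨Submodule.map_subtype_le Y W, hW⟩
  · intro A hA
    simp only [mem_filter, mem_univ, true_and] at hA ⊢
    rw [key A hA.1]
    exact hA.2
  · intro W _
    exact Submodule.comap_map_eq_of_injective Y.injective_subtype W
  · intro A hA
    exact key A (mem_filter.1 hA).2.1
  · intros; rfl

theorem card_le_finrank_eq (Y : Submodule K V) (u : ℕ) :
    #{A : Submodule K V | A ≤ Y ∧ finrank K A = u} = gaussBinom K (finrank K Y) u := by
  have h := sum_map_subtype Y (fun A => finrank K A = u) (fun _ => 1)
  simp only [Submodule.finrank_map_subtype_eq, sum_const, smul_eq_mul, mul_one] at h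
  rw [← h, card_finrank_eq]

theorem card_ge_finrank_eq (T : Submodule K V) (u : ℕ) :
    #{A : Submodule K V | T ≤ A ∧ finrank K A = finrank K T + u} =
      gaussBinom K (finrank K V - finrank K T) u := by
  have h := sum_comap_mkQ T (fun A => finrank K A = finrank K T + u) (fun _ => 1)
  simp only [finrank_comap_mkQ, sum_const, smul_eq_mul, mul_one, add_right_inj] at h
  rw [← h, card_finrank_eq, Submodule.finrank_quotient]

theorem card_Icc_finrank_eq {S Y : Submodule K V} (hSY : S ≤ Y) (u : ℕ) :
    #{A : Submodule K V | (S ≤ A ∧ A ≤ Y) ∧ finrank K A = finrank K S + u} =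
      gaussBinom K (finrank K Y - finrank K S) u := by
  have h := sum_map_subtype Y (fun A => S ≤ A ∧ finrank K A = finrank K S + u) (fun _ => 1)
  simp only [Submodule.finrank_map_subtype_eq, sum_const, smul_eq_mul, mul_one] at h
  have h2 := card_ge_finrank_eq (S.comap Y.subtype) u
  rw [(Submodule.comapSubtypeEquivOfLe hSY).finrank_eq] at h2
  rw [← h2]
  have h3 : ∀ W : Submodule K Y, S.comap Y.subtype ≤ W ↔ S ≤ W.map Y.subtype := by
    intro W
    constructor
    · intro hW
      have := Submodule.map_mono (f := Y.subtype) hW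
      rwa [Submodule.map_comap_subtype, inf_eq_right.2 hSY] at this
    · intro hW
      have := Submodule.comap_mono (f := Y.subtype) hW
      rwa [Submodule.comap_map_eq_of_injective Y.injective_subtype] at this
  simp only [h3]
  rw [h]
  congr 1
  ext A
  simp only [mem_filter, mem_univ, true_and]
  tauto

theorem gaussBinom_zero_right (c : ℕ) : gaussBinom K c 0 = 1 := by
  rw [gaussBinom, card_eq_one]
  exact ⟨⊥, by ext W; simp [Submodule.finrank_eq_zero]⟩

theorem gaussBinom_self (c : ℕ) : gaussBinom K c c = 1 := by
  rw [gaussBinom, card_eq_one]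
  refine ⟨⊤, ?_⟩
  ext W
  simp only [mem_filter, mem_univ, true_and, mem_singleton]
  constructor
  · intro h
    exact Submodule.eq_top_of_finrank_eq (by simpa using h)
  · rintro rfl
    simp

theorem gaussBinom_eq_zero {c u : ℕ} (h : c < u) : gaussBinom K c u = 0 := by
  rw [gaussBinom, card_eq_zero, filter_eq_empty_iff]
  intro W _ hW
  have := Submodule.finrank_le W
  rw [finrank_fin_fun] at this
  omega

theorem gaussBinom_one_right (c : ℕ) :
    gaussBinom K c 1 = ∑ k ∈ range c, Nat.card K ^ k := by
  rw [← Projectivization.card_of_finrank K (Fin c → K) (finrank_fin_fun K),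
    Nat.card_congr (Projectivization.equivSubmodule K (Fin c → K)), gaussBinom,
    Nat.card_eq_fintype_card, Fintype.card_subtype]

/-- Hyperplanes are counted by points, through the annihilator in the dual space. -/
theorem gaussBinom_succ_self (c : ℕ) : gaussBinom K (c + 1) c = gaussBinom K (c + 1) 1 := by
  have h := card_finrank_eq (K := K) (V := Dual K (Fin (c + 1) → K)) 1
  rw [Subspace.dual_finrank_eq, finrank_fin_fun] at h
  rw [← h, gaussBinom]
  refine Finset.card_equiv ((Subspace.orderIsoFiniteDimensional (K := K)
    (V := Fin (c + 1) → K)).toEquiv.trans OrderDual.ofDual) fun W => ?_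
  have h1 := Subspace.finrank_add_finrank_dualAnnihilator_eq W
  rw [finrank_fin_fun] at h1
  have h2 : ((Subspace.orderIsoFiniteDimensional (K := K)
    (V := Fin (c + 1) → K)).toEquiv.trans OrderDual.ofDual) W = W.dualAnnihilator := rfl
  simp only [mem_filter, mem_univ, true_and, h2]
  omega

/-- Double counting of the flags of dimensions `u` and `u + 1`. -/
theorem gaussBinom_succ_mul (c u : ℕ) :
    gaussBinom K c (u + 1) * gaussBinom K (u + 1) 1 =
      gaussBinom K c u * gaussBinom K (c - u) 1 := by
  have h := Finset.sum_comm' (s := ({W | finrank K W = u + 1} : Finset (Submodule K (Fin c → K))))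
    (t := fun W => {U | U ≤ W ∧ finrank K U = u})
    (t' := ({U | finrank K U = u} : Finset (Submodule K (Fin c → K))))
    (s' := fun U => {W | U ≤ W ∧ finrank K W = u + 1}) (f := fun _ _ => 1)
    (by intro W U; simp only [mem_filter, mem_univ, true_and]; tauto)
  simp only [sum_const, smul_eq_mul, mul_one] at h
  have h1 : ∀ W ∈ ({W | finrank K W = u + 1} : Finset (Submodule K (Fin c → K))),
      #{U | U ≤ W ∧ finrank K U = u} = gaussBinom K (u + 1) 1 := by
    intro W hW
    rw [card_le_finrank_eq, (mem_filter.1 hW).2, gaussBinom_succ_self]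
  have h2 : ∀ U ∈ ({U | finrank K U = u} : Finset (Submodule K (Fin c → K))),
      #{W | U ≤ W ∧ finrank K W = u + 1} = gaussBinom K (c - u) 1 := by
    intro U hU
    have := card_ge_finrank_eq U 1
    rwa [(mem_filter.1 hU).2, finrank_fin_fun] at this
  rw [sum_congr rfl h1, sum_congr rfl h2, sum_const, sum_const, smul_eq_mul, smul_eq_mul] at h
  exact h

variable {F : Type*} [Field F]

/-- The `q`-integer `[c]_q = 1 + q + ⋯ + q^(c-1)` in `F`, with `q = |K|`. -/
def qInt (K F : Type*) [Field F] (c : ℕ) : F := ∑ k ∈ range c, (Nat.card K : F) ^ k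

theorem cast_gaussBinom_one_right (c : ℕ) : (gaussBinom K c 1 : F) = qInt K F c := by
  simp [gaussBinom_one_right, qInt]

theorem qInt_sub_qInt {a b : ℕ} (h : b ≤ a) :
    qInt K F a - qInt K F b = (Nat.card K : F) ^ b * qInt K F (a - b) := by
  obtain ⟨e, rfl⟩ := Nat.exists_eq_add_of_le h
  rw [Nat.add_sub_cancel_left, qInt, qInt, qInt, sum_range_add, add_sub_cancel_left, mul_sum]
  simp only [pow_add]

theorem exists_gaussBinom_mul_eq_prod (u : ℕ) : ∃ w : F, ∀ c : ℕ,
    (gaussBinom K c u : F) * w = ∏ k ∈ range u, (qInt K F c - qInt K F k) := by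
  induction u with
  | zero => exact ⟨1, fun c => by simp [gaussBinom_zero_right]⟩
  | succ u ih =>
    obtain ⟨w, hw⟩ := ih
    refine ⟨qInt K F (u + 1) * (Nat.card K : F) ^ u * w, fun c => ?_⟩
    rw [prod_range_succ, ← hw c]
    rcases le_or_gt u c with h | h
    · have h1 := congrArg (Nat.cast : ℕ → F) (gaussBinom_succ_mul (K := K) c u)
      push_cast at h1
      rw [cast_gaussBinom_one_right, cast_gaussBinom_one_right] at h1
      rw [qInt_sub_qInt h]
      linear_combination ((Nat.card K : F) ^ u * w) * h1
    · rw [gaussBinom_eq_zero h, gaussBinom_eq_zero (h.trans (Nat.lt_succ_self u))]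
      simp

variable {m : ℕ}

theorem qInt_injOn (hq : (Nat.card K : F) ≠ 0) (hm : ∀ i ∈ Icc 1 m, qInt K F i ≠ 0)
    {a b : ℕ} (ha : a ≤ m) (hb : b ≤ m) (h : qInt K F a = qInt K F b) : a = b := by
  wlog hab : b ≤ a generalizing a b
  · exact (this hb ha h.symm (by omega)).symm
  by_contra hne
  have h1 := qInt_sub_qInt (K := K) (F := F) hab
  rw [h, sub_self] at h1
  exact mul_ne_zero (pow_ne_zero _ hq) (hm (a - b) (mem_Icc.2 ⟨by omega, by omega⟩)) h1.symm

theorem gaussBinom_ne_zero (hq : (Nat.card K : F) ≠ 0) (hm : ∀ i ∈ Icc 1 m, qInt K F i ≠ 0)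
    {c u : ℕ} (hc : c ≤ m) (hu : u ≤ c) : (gaussBinom K c u : F) ≠ 0 := by
  obtain ⟨w, hw⟩ := exists_gaussBinom_mul_eq_prod (K := K) (F := F) u
  intro h
  have h1 := hw c
  rw [h, zero_mul] at h1
  obtain ⟨k, hk, h2⟩ := prod_eq_zero_iff.1 h1.symm
  have hk := mem_range.1 hk
  have := qInt_injOn hq hm hc (by omega) (sub_eq_zero.1 h2)
  omega

/-- The matrix `([m - j choose u]_q)` with `j ∈ R` and `u < |R|` is nonsingular: up to nonzero
factors its entries are the values at the distinct points `[m - j]_q` of polynomials of degrees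
`0, 1, 2, …`. -/
theorem eq_zero_of_sum_gaussBinom_eq_zero (hq : (Nat.card K : F) ≠ 0)
    (hm : ∀ i ∈ Icc 1 m, qInt K F i ≠ 0) (R : Finset ℕ) (hR : ∀ j ∈ R, j ≤ m) (δ : ℕ → F)
    (h : ∀ u < #R, ∑ j ∈ R, δ j * (gaussBinom K (m - j) u : F) = 0) :
    ∀ j ∈ R, δ j = 0 := by
  open Polynomial in
  set x : ℕ → F := fun j => qInt K F (m - j) with hx
  have hbasis : ∀ u < #R, ∑ j ∈ R, δ j * (∏ k ∈ range u, (X - C (qInt K F k))).eval (x j) = 0 := by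
    intro u hu
    obtain ⟨w, hw⟩ := exists_gaussBinom_mul_eq_prod (K := K) (F := F) u
    have : ∀ j ∈ R, δ j * (∏ k ∈ range u, (X - C (qInt K F k))).eval (x j) =
        δ j * (gaussBinom K (m - j) u : F) * w := by
      intro j _
      rw [mul_assoc, hw, eval_prod]
      simp [hx]
    rw [sum_congr rfl this, ← sum_mul, h u hu, zero_mul]
  have hall : ∀ N ≤ #R, ∀ P : F[X], P.degree < N → ∑ j ∈ R, δ j * P.eval (x j) = 0 := by
    intro N
    induction N with
    | zero =>
      intro _ P hP
      have : P = 0 := by simpa using hP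
      simp [this]
    | succ N ih =>
      intro hN P hP
      set W : F[X] := ∏ k ∈ range N, (X - C (qInt K F k)) with hW
      have hmon : W.Monic := monic_prod_of_monic _ _ fun k _ => monic_X_sub_C _
      have hdeg : W.natDegree = N := by
        rw [hW, natDegree_prod_of_monic _ _ fun k _ => monic_X_sub_C _]
        simp
      have hQ : (P - C (P.coeff N) * W).degree < N := by
        rw [degree_lt_iff_coeff_zero]
        intro i hi
        rcases hi.eq_or_lt with rfl | hi
        · have h1 : W.coeff N = 1 := by
            have := hmon.coeff_natDegree
            rwa [hdeg] at this
          simp [h1]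
        · have h1 : W.coeff i = 0 := coeff_eq_zero_of_natDegree_lt (by omega)
          have h2 : P.coeff i = 0 := (degree_lt_iff_coeff_zero _ _).1 hP i hi
          simp [h1, h2]
      have h1 := ih (by omega) _ hQ
      have h2 := hbasis N (by omega)
      rw [← hW] at h2
      simp only [eval_sub, eval_mul, eval_C, mul_sub, sum_sub_distrib] at h1
      have h3 : ∑ j ∈ R, δ j * (P.coeff N * W.eval (x j)) = 0 := by
        rw [← mul_zero (P.coeff N), ← h2, mul_sum]
        exact sum_congr rfl fun j _ => by ring
      rwa [h3, sub_zero] at h1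
  intro j hj
  have h1 := hall #R le_rfl (∏ i ∈ R.erase j, (X - C (x i))) (by
    rw [degree_prod_of_monic _ _ fun k _ => monic_X_sub_C _]
    simp only [degree_X_sub_C, sum_const, nsmul_eq_mul, mul_one, card_erase_of_mem hj]
    have := card_pos.2 ⟨j, hj⟩
    exact_mod_cast (by omega : #R - 1 < #R))
  rw [sum_eq_single_of_mem j hj] at h1
  · refine (mul_eq_zero.1 h1).resolve_right ?_
    rw [eval_prod]
    refine prod_ne_zero_iff.2 ?_
    intro i hi
    simp only [eval_sub, eval_X, eval_C]
    intro h2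
    have := qInt_injOn hq hm (Nat.sub_le m j) (Nat.sub_le m i) (sub_eq_zero.1 h2)
    have h3 := hR j hj
    have h4 := hR i (mem_of_mem_erase hi)
    exact (mem_erase.1 hi).1 (by omega)
  · intro i hi hij
    rw [eval_prod, prod_eq_zero (mem_erase.2 ⟨hij, hi⟩) (by simp), mul_zero]

/-- A unitriangular homogeneous system has only the zero solution; `ν` is the order in which the
unknowns are eliminated. -/
theorem eq_zero_of_unitriangular (s : Finset ℕ) (ν : ℕ → ℕ) (c : ℕ → ℕ → F) (δ : ℕ → F)
    (hdiag : ∀ i ∈ s, c i i = 1)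
    (hc : ∀ i ∈ s, ∀ l ∈ s, l ≠ i → ν i ≤ ν l → c i l = 0)
    (h : ∀ i ∈ s, ∑ l ∈ s, c i l * δ l = 0) : ∀ i ∈ s, δ i = 0 := by
  have key : ∀ N, ∀ i ∈ s, ν i = N → δ i = 0 := by
    intro N
    induction N using Nat.strong_induction_on with
    | _ N ih =>
      intro i hi hN
      have h1 := h i hi
      rw [sum_eq_single_of_mem i hi, hdiag i hi, one_mul] at h1
      · exact h1
      · intro l hl hli
        rcases lt_or_ge (ν l) (ν i) with h2 | h2
        · rw [ih (ν l) (hN ▸ h2) l hl rfl, mul_zero]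
        · rw [hc i hi l hl hli h2, zero_mul]
  exact fun i hi => key _ i hi rfl

end Counting

/-! ### Möbius inversion for the weights -/

section Weights

variable {K V : Type*} [Field K] [Finite K] [AddCommGroup V] [Module K V] [FiniteDimensional K V]

/-- The Möbius function of the lattice of subspaces of `V / T` is that of the interval above `T`. -/
theorem mu_bot_eq_mu_comap_mkQ (T : Submodule K V) (B : Submodule K (V ⧸ T)) :
    IncidenceAlgebra.mu ℤ (⊥ : Submodule K (V ⧸ T)) B =
      IncidenceAlgebra.mu ℤ T (B.comap T.mkQ) := by
  induction B using WellFoundedLT.induction with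
  | ind B ih =>
    have hbot : (⊥ : Submodule K (V ⧸ T)).comap T.mkQ = T := by
      rw [Submodule.comap_bot, Submodule.ker_mkQ]
    have hinj : Function.Injective (Submodule.comap T.mkQ) :=
      Submodule.comap_injective_of_surjective T.mkQ_surjective
    by_cases hB : B = ⊥
    · subst hB
      rw [hbot, IncidenceAlgebra.mu_self, IncidenceAlgebra.mu_self]
    have hB' : T ≠ B.comap T.mkQ := fun h => hB (hinj (h ▸ hbot.symm ▸ rfl))
    rw [IncidenceAlgebra.mu_eq_neg_sum_Ico_of_ne (Ne.symm hB),
      IncidenceAlgebra.mu_eq_neg_sum_Ico_of_ne hB', neg_inj]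
    have h := sum_comap_mkQ T (fun A => A < B.comap T.mkQ) (fun A => IncidenceAlgebra.mu ℤ T A)
    have e1 : Ico (⊥ : Submodule K (V ⧸ T)) B =
        ({W | W.comap T.mkQ < B.comap T.mkQ} : Finset (Submodule K (V ⧸ T))) := by
      ext W
      simp only [mem_Ico, bot_le, true_and, mem_filter, mem_univ]
      simp only [lt_iff_le_not_ge, Submodule.comap_le_comap_iff_of_surjective T.mkQ_surjective]
    have e2 : Ico T (B.comap T.mkQ) =
        ({A | T ≤ A ∧ A < B.comap T.mkQ} : Finset (Submodule K V)) := by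
      ext W
      simp
    rw [e1, e2, ← h]
    refine sum_congr rfl fun W hW => ih W ?_
    rw [← e1] at hW
    exact (mem_Ico.1 hW).2

namespace QPolymatroid

variable {r : ℕ} (M : QPolymatroid K V r)

theorem ell_contract (T : Submodule K V) (W : Submodule K (V ⧸ T)) :
    (M.contract T).ell W = M.ell (W.comap T.mkQ) := by
  have h1 := M.mono _ _ (T.le_comap_mkQ W)
  simp only [ell, contract, Submodule.comap_top]
  omega

variable {F : Type*} [Field F]

theorem aeval_charPoly_contract (θ : F) (T : Submodule K V) :
    Polynomial.aeval θ (M.contract T).charPoly =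
      ∑ A : Submodule K V with T ≤ A, (IncidenceAlgebra.mu ℤ T A : F) * θ ^ M.ell A := by
  have h := sum_comap_mkQ T (fun _ => True)
    (fun A => (IncidenceAlgebra.mu ℤ T A : F) * θ ^ M.ell A)
  simp only [filter_true, and_true] at h
  rw [← h, charPoly, map_sum]
  refine sum_congr rfl fun W _ => ?_
  rw [map_mul, map_pow, Polynomial.aeval_X, Polynomial.aeval_C, ell_contract,
    mu_bot_eq_mu_comap_mkQ]
  simp

/-- Möbius inversion of the definition of `p(M.X;θ)`. -/
theorem sum_weight_le (p : Perp K V) (θ : F) (Y : Submodule K V) :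
    ∑ X : Submodule K V with X ≤ Y, M.weight p θ X = θ ^ M.ell (p.map Y) := by
  have h1 : ∑ X : Submodule K V with X ≤ Y, M.weight p θ X =
      ∑ S : Submodule K V with p.map Y ≤ S,
        ∑ A : Submodule K V with S ≤ A, (IncidenceAlgebra.mu ℤ S A : F) * θ ^ M.ell A := by
    refine sum_nbij' p.map p.map ?_ ?_ ?_ ?_ ?_
    · intro X hX
      simp only [mem_filter, mem_univ, true_and] at hX ⊢
      exact p.antitone _ _ hX
    · intro S hS
      simp only [mem_filter, mem_univ, true_and] at hS ⊢
      simpa only [p.invol] using p.antitone _ _ hS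
    · intro X _; exact p.invol X
    · intro X _; exact p.invol X
    · intro X _
      exact M.aeval_charPoly_contract θ (p.map X)
  rw [h1, sum_comm' (t' := univ) (s' := fun A => Icc (p.map Y) A)
    (by intro S A; simp only [mem_filter, mem_univ, true_and, mem_Icc, and_true])]
  have h2 : ∀ A ∈ (univ : Finset (Submodule K V)),
      ∑ S ∈ Icc (p.map Y) A, (IncidenceAlgebra.mu ℤ S A : F) * θ ^ M.ell A =
        if p.map Y = A then θ ^ M.ell A else 0 := by
    intro A _
    rw [← sum_mul, ← Int.cast_sum, IncidenceAlgebra.sum_Icc_mu_left]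
    split_ifs <;> simp
  rw [sum_congr rfl h2, sum_ite_eq, if_pos (mem_univ _)]

theorem aeval_weightEnum (p : Perp K V) (θ : F) (i : ℕ) :
    Polynomial.aeval θ (M.weightEnum p i) =
      ∑ X ∈ {X : Submodule K V | finrank K X = i}, M.weight p θ X := by
  rw [weightEnum, map_sum]
  rfl

theorem weight_bot (p : Perp K V) (θ : F) : M.weight p θ ⊥ = 1 := by
  have h := M.sum_weight_le p θ ⊥
  have h0 : p.map ⊥ = ⊤ := by
    have := p.antitone _ _ (bot_le : ⊥ ≤ p.map ⊤)
    rw [p.invol] at this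
    exact top_le_iff.1 this
  simpa [h0, ell, filter_eq'] using h

theorem aeval_weightEnum_zero (p : Perp K V) (θ : F) :
    Polynomial.aeval θ (M.weightEnum p 0) = 1 := by
  rw [aeval_weightEnum]
  simp [Submodule.finrank_eq_zero, filter_eq', weight_bot]

/-- The power sums of `ℓ_M` over the subspaces of fixed dimension, in terms of the weight
enumerators. The right-hand side depends on the anti-isomorphism only through these. -/
theorem sum_pow_ell (p : Perp K V) (θ : F) (u : ℕ) :
    ∑ W ∈ {W : Submodule K V | finrank K W = u}, θ ^ M.ell W =
      ∑ j ∈ range (finrank K V + 1),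
        Polynomial.aeval θ (M.weightEnum p j) * (gaussBinom K (finrank K V - j) u : F) := by
  have h1 : ∀ W ∈ ({W | finrank K W = u} : Finset (Submodule K V)),
      θ ^ M.ell W = ∑ X : Submodule K V with X ≤ p.map W, M.weight p θ X := by
    intro W _
    rw [sum_weight_le, p.invol]
  rw [sum_congr rfl h1, sum_comm' (t' := univ)
    (s' := fun X => {W | W ≤ p.map X ∧ finrank K W = u})]
  · rw [← sum_fiberwise_of_maps_to (t := range (finrank K V + 1))
      (g := fun X : Submodule K V => finrank K X)]
    · refine sum_congr rfl fun j _ => ?_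
      rw [aeval_weightEnum, sum_mul]
      refine sum_congr rfl fun X hX => ?_
      have hX := (mem_filter.1 hX).2
      have h2 := p.finrank_map X
      rw [sum_const, card_le_finrank_eq, nsmul_eq_mul, mul_comm,
        (by omega : finrank K (p.map X) = finrank K V - j)]
    · intro X _
      exact mem_range.2 (Nat.lt_succ_of_le (Submodule.finrank_le X))
  · intro W X
    simp only [mem_filter, mem_univ, true_and, and_true]
    have : X ≤ p.map W ↔ W ≤ p.map X := by
      constructor <;> intro h <;> simpa only [p.invol] using p.antitone _ _ h
    rw [this, and_comm]

end QPolymatroid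

end Weights

/-! ### From sums over upper intervals to designs -/

section Designs

variable {K V F : Type*} [Field K] [Finite K] [AddCommGroup V] [Module K V]
  [FiniteDimensional K V] [Field F]

theorem card_ge_finrank_eq_ite (T : Submodule K V) (i : ℕ) :
    #{A : Submodule K V | T ≤ A ∧ finrank K A = i} =
      if finrank K T ≤ i then gaussBinom K (finrank K V - finrank K T) (i - finrank K T) else 0 := by
  split_ifs with h
  · rw [← card_ge_finrank_eq, Nat.add_sub_cancel' h]
  · rw [card_eq_zero, filter_eq_empty_iff]
    rintro A _ ⟨h1, rfl⟩
    exact h (Submodule.finrank_mono h1)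

/-- If the sums of `A ↦ ∑_{Y ≤ A} f(Y)` over the `i`-dimensional `A ≥ T` are the same for `T` and
`T'`, then so are the sums of `f` over the `Y` with `dim (Y + T) = l`: the two families of sums are
related by a unitriangular matrix. -/
theorem sum_finrank_sup_eq_of_sum_ge_eq (f : Submodule K V → F) {t : ℕ} {T T' : Submodule K V}
    (hT : finrank K T = t) (hT' : finrank K T' = t)
    (h : ∀ i ∈ Icc t (finrank K V),
      ∑ A ∈ {A : Submodule K V | T ≤ A ∧ finrank K A = i}, ∑ Y ∈ {Y | Y ≤ A}, f Y =
      ∑ A ∈ {A : Submodule K V | T' ≤ A ∧ finrank K A = i}, ∑ Y ∈ {Y | Y ≤ A}, f Y) :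
    ∀ l ∈ Icc t (finrank K V),
      ∑ Y ∈ {Y : Submodule K V | finrank K (Y ⊔ T : Submodule K V) = l}, f Y =
      ∑ Y ∈ {Y : Submodule K V | finrank K (Y ⊔ T' : Submodule K V) = l}, f Y := by
  set c : ℕ → ℕ → F := fun i l =>
    ((if l ≤ i then gaussBinom K (finrank K V - l) (i - l) else 0 : ℕ) : F) with hc
  have key : ∀ T : Submodule K V, finrank K T = t → ∀ i,
      ∑ A ∈ {A : Submodule K V | T ≤ A ∧ finrank K A = i}, ∑ Y ∈ {Y | Y ≤ A}, f Y =
      ∑ l ∈ Icc t (finrank K V), c i l *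
        ∑ Y ∈ {Y : Submodule K V | finrank K (Y ⊔ T : Submodule K V) = l}, f Y := by
    intro T hT i
    rw [sum_comm' (t' := univ) (s' := fun Y => {A | Y ⊔ T ≤ A ∧ finrank K A = i})]
    · rw [← sum_fiberwise_of_maps_to (t := Icc t (finrank K V))
        (g := fun Y : Submodule K V => finrank K (Y ⊔ T : Submodule K V))]
      · refine sum_congr rfl fun l _ => ?_
        rw [mul_sum]
        refine sum_congr rfl fun Y hY => ?_
        rw [sum_const, card_ge_finrank_eq_ite, (mem_filter.1 hY).2, nsmul_eq_mul]
      · intro Y _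
        exact mem_Icc.2 ⟨hT ▸ Submodule.finrank_mono le_sup_right, Submodule.finrank_le _⟩
    · intro A Y
      simp only [mem_filter, mem_univ, true_and, and_true, sup_le_iff]
      tauto
  intro l hl
  rw [← sub_eq_zero]
  refine eq_zero_of_unitriangular (Icc t (finrank K V)) id c
    (fun l => ∑ Y ∈ {Y : Submodule K V | finrank K (Y ⊔ T : Submodule K V) = l}, f Y -
      ∑ Y ∈ {Y : Submodule K V | finrank K (Y ⊔ T' : Submodule K V) = l}, f Y) ?_ ?_ ?_ l hl
  · intro i _
    simp [hc, gaussBinom_zero_right]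
  · intro i _ l _ hne hle
    have : ¬ l ≤ i := fun h' => hne (le_antisymm h' hle)
    simp [hc, this]
  · intro i hi
    simp only [mul_sub, sum_sub_distrib]
    rw [← key T hT, ← key T' hT', h i hi, sub_self]

/-- A weighted `t`-design of `k`-dimensional subspaces is a weighted `s`-design for `s ≤ t`, provided
that `[k - s choose t - s]_q` can be inverted. -/
theorem exists_sum_ge_eq_of_le (f : Submodule K V → F) {k s t : ℕ} {lam : F} (hst : s ≤ t)
    (hne : (gaussBinom K (k - s) (t - s) : F) ≠ 0)
    (h : ∀ T : Submodule K V, finrank K T = t →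
      ∑ Y ∈ {Y : Submodule K V | finrank K Y = k ∧ T ≤ Y}, f Y = lam) :
    ∃ lam' : F, ∀ S : Submodule K V, finrank K S = s →
      ∑ Y ∈ {Y : Submodule K V | finrank K Y = k ∧ S ≤ Y}, f Y = lam' := by
  refine ⟨gaussBinom K (finrank K V - s) (t - s) * lam / gaussBinom K (k - s) (t - s),
    fun S hS => ?_⟩
  rw [eq_div_iff hne]
  have h1 : ∑ T ∈ {T : Submodule K V | S ≤ T ∧ finrank K T = t},
      ∑ Y ∈ {Y : Submodule K V | finrank K Y = k ∧ T ≤ Y}, f Y =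
      gaussBinom K (finrank K V - s) (t - s) * lam := by
    rw [sum_congr rfl fun T hT => h T (mem_filter.1 hT).2.2, sum_const, card_ge_finrank_eq_ite, hS,
      if_pos hst, nsmul_eq_mul]
  rw [← h1, sum_comm' (t' := {Y : Submodule K V | finrank K Y = k ∧ S ≤ Y})
    (s' := fun Y => {T | (S ≤ T ∧ T ≤ Y) ∧ finrank K T = t}), sum_mul]
  · refine sum_congr rfl fun Y hY => ?_
    obtain ⟨hY, hSY⟩ := (mem_filter.1 hY).2
    have h2 := card_Icc_finrank_eq hSY (t - s)
    rw [hS, Nat.add_sub_cancel' hst, hY] at h2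
    rw [sum_const, h2, nsmul_eq_mul, mul_comm]
  · intro T Y
    simp only [mem_filter, mem_univ, true_and]
    constructor
    · rintro ⟨⟨h1, h2⟩, h3, h4⟩
      exact ⟨⟨⟨h1, h4⟩, h2⟩, h3, h1.trans h4⟩
    · rintro ⟨⟨⟨h1, h2⟩, h3⟩, h4, _⟩
      exact ⟨⟨h1, h3⟩, h4, h2⟩

/-- Block intersection numbers of a weighted design: if the family is an `s`-design for every
`s ≤ t`, then the total weight of the blocks `Y` with `dim (Y ∩ T) = a` does not depend on the
`t`-dimensional space `T`. -/
theorem sum_finrank_inf_eq (f : Submodule K V → F) {k t : ℕ} (lam : ℕ → F)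
    (h : ∀ s ≤ t, ∀ S : Submodule K V, finrank K S = s →
      ∑ Y ∈ {Y : Submodule K V | finrank K Y = k ∧ S ≤ Y}, f Y = lam s)
    {T T' : Submodule K V} (hT : finrank K T = t) (hT' : finrank K T' = t) (a : ℕ) (ha : a ≤ t) :
    ∑ Y ∈ {Y : Submodule K V | finrank K Y = k ∧ finrank K (Y ⊓ T : Submodule K V) = a}, f Y =
    ∑ Y ∈ {Y : Submodule K V | finrank K Y = k ∧ finrank K (Y ⊓ T' : Submodule K V) = a}, f Y := by
  have key : ∀ T : Submodule K V, finrank K T = t → ∀ s ∈ range (t + 1),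
      ∑ a ∈ range (t + 1), (gaussBinom K a s : F) *
        ∑ Y ∈ {Y : Submodule K V | finrank K Y = k ∧ finrank K (Y ⊓ T : Submodule K V) = a}, f Y =
      gaussBinom K t s * lam s := by
    intro T hT s hs
    have hs' : s ≤ t := Nat.lt_succ_iff.1 (mem_range.1 hs)
    have h1 : ∑ S ∈ {S : Submodule K V | S ≤ T ∧ finrank K S = s},
        ∑ Y ∈ {Y : Submodule K V | finrank K Y = k ∧ S ≤ Y}, f Y = gaussBinom K t s * lam s := by
      rw [sum_congr rfl fun S hS => h s hs' S (mem_filter.1 hS).2.2, sum_const,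
        card_le_finrank_eq, hT, nsmul_eq_mul]
    rw [← h1, sum_comm' (t' := {Y : Submodule K V | finrank K Y = k})
      (s' := fun Y => {S | S ≤ Y ⊓ T ∧ finrank K S = s})]
    · rw [← sum_fiberwise_of_maps_to (s := {Y : Submodule K V | finrank K Y = k})
        (t := range (t + 1)) (g := fun Y : Submodule K V => finrank K (Y ⊓ T : Submodule K V))]
      · refine sum_congr rfl fun a _ => ?_
        rw [mul_sum, filter_filter]
        refine sum_congr rfl fun Y hY => ?_
        rw [sum_const, card_le_finrank_eq, (mem_filter.1 hY).2.2, nsmul_eq_mul]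
      · intro Y _
        exact mem_range.2 (Nat.lt_succ_of_le (hT ▸ Submodule.finrank_mono inf_le_right))
    · intro S Y
      simp only [mem_filter, mem_univ, true_and, le_inf_iff]
      tauto
  rw [← sub_eq_zero]
  refine eq_zero_of_unitriangular (range (t + 1)) (fun a => t - a)
    (fun s a => (gaussBinom K a s : F)) (fun a =>
    ∑ Y ∈ {Y : Submodule K V | finrank K Y = k ∧ finrank K (Y ⊓ T : Submodule K V) = a}, f Y -
    ∑ Y ∈ {Y : Submodule K V | finrank K Y = k ∧ finrank K (Y ⊓ T' : Submodule K V) = a}, f Y)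
    ?_ ?_ ?_ a (mem_range.2 (Nat.lt_succ_of_le ha))
  · intro i _
    simp [gaussBinom_self]
  · intro i hi l hl hne hle
    have := mem_range.1 hi
    have := mem_range.1 hl
    rw [gaussBinom_eq_zero (by omega), Nat.cast_zero]
  · intro i hi
    simp only [mul_sub, sum_sub_distrib]
    rw [key T hT i hi, key T' hT' i hi, sub_self]

theorem exists_eq_of_forall_eq {t : ℕ} (g : Submodule K V → F)
    (h : ∀ T T' : Submodule K V, finrank K T = t → finrank K T' = t → g T = g T') :
    ∃ lam, ∀ T : Submodule K V, finrank K T = t → g T = lam := by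
  by_cases hT : ∃ T : Submodule K V, finrank K T = t
  · obtain ⟨T₀, h₀⟩ := hT
    exact ⟨g T₀, fun T hT => h T T₀ hT h₀⟩
  · exact ⟨0, fun T hT' => absurd ⟨T, hT'⟩ hT⟩

/-- If the total weight of the `Y` with `dim (Y + T) = l` does not depend on `T`, then the spaces of
each dimension form a weighted `t`-design. By induction on the dimension: a `Y` with
`dim (Y + T) = j` either contains `T` and has dimension `j`, or has smaller dimension, and the
smaller ones contribute intersection numbers of designs. -/
theorem sum_ge_eq_of_sum_finrank_sup_eq (f : Submodule K V → F) {t d m : ℕ} (htd : t < d)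
    (hmV : m ≤ finrank K V)
    (hq : (Nat.card K : F) ≠ 0) (hm : ∀ i ∈ Icc 1 m, qInt K F i ≠ 0)
    (hf : ∀ Y : Submodule K V, 0 < finrank K Y → finrank K Y < d → f Y = 0)
    (h : ∀ T T' : Submodule K V, finrank K T = t → finrank K T' = t → ∀ l ∈ Icc t (finrank K V),
      ∑ Y ∈ {Y : Submodule K V | finrank K (Y ⊔ T : Submodule K V) = l}, f Y =
      ∑ Y ∈ {Y : Submodule K V | finrank K (Y ⊔ T' : Submodule K V) = l}, f Y)
    (j : ℕ) (hj : 0 < j) (hjm : j ≤ m) :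
    ∃ lam : F, ∀ T : Submodule K V, finrank K T = t →
      ∑ Y ∈ {Y : Submodule K V | finrank K Y = j ∧ T ≤ Y}, f Y = lam := by
  induction j using Nat.strong_induction_on with
  | _ j ih =>
    rcases lt_or_ge j d with hjd | hjd
    · refine ⟨0, fun T _ => sum_eq_zero fun Y hY => ?_⟩
      have := (mem_filter.1 hY).2.1
      exact hf Y (by omega) (by omega)
    refine exists_eq_of_forall_eq _ fun T T' hT hT' => ?_
    have split : ∀ T : Submodule K V, finrank K T = t →
        ∑ Y ∈ {Y : Submodule K V | finrank K (Y ⊔ T : Submodule K V) = j}, f Y =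
        ∑ k ∈ range j, ∑ Y ∈ {Y : Submodule K V | finrank K Y = k ∧
            finrank K (Y ⊓ T : Submodule K V) + j = k + t}, f Y +
          ∑ Y ∈ {Y : Submodule K V | finrank K Y = j ∧ T ≤ Y}, f Y := by
      intro T hT
      rw [← sum_fiberwise_of_maps_to (t := range (j + 1))
        (g := fun Y : Submodule K V => finrank K Y), sum_range_succ]
      · congr 1
        · refine sum_congr rfl fun k _ => sum_congr ?_ fun _ _ => rfl
          ext Y
          have := Submodule.finrank_sup_add_finrank_inf_eq Y T
          simp only [mem_filter, mem_univ, true_and]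
          omega
        · refine sum_congr ?_ fun _ _ => rfl
          ext Y
          simp only [mem_filter, mem_univ, true_and]
          constructor
          · rintro ⟨h1, h2⟩
            have : Y = Y ⊔ T := Submodule.eq_of_le_of_finrank_eq le_sup_left (by rw [h1, h2])
            exact ⟨h2, this ▸ le_sup_right⟩
          · rintro ⟨h1, h2⟩
            rw [sup_eq_left.2 h2]
            exact ⟨h1, h1⟩
      · intro Y hY
        rw [← (mem_filter.1 hY).2]
        exact mem_range.2 (Nat.lt_succ_of_le (Submodule.finrank_mono le_sup_left))
    have h1 := h T T' hT hT' j (mem_Icc.2 ⟨by omega, by omega⟩)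
    rw [split T hT, split T' hT'] at h1
    have h2 : ∀ k ∈ range j,
        ∑ Y ∈ {Y : Submodule K V | finrank K Y = k ∧
            finrank K (Y ⊓ T : Submodule K V) + j = k + t}, f Y =
        ∑ Y ∈ {Y : Submodule K V | finrank K Y = k ∧
            finrank K (Y ⊓ T' : Submodule K V) + j = k + t}, f Y := by
      intro k hk
      have hk := mem_range.1 hk
      rcases lt_or_ge (k + t) j with hkt | hkt
      · rw [filter_false_of_mem (by rintro Y -; omega), filter_false_of_mem (by rintro Y -; omega)]
      rcases lt_or_ge k d with hkd | hkd
      · rw [sum_eq_zero, sum_eq_zero] <;>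
        · intro Y hY
          have := (mem_filter.1 hY).2.1
          exact hf Y (by omega) (by omega)
      obtain ⟨lam, hlam⟩ := ih k hk (by omega) (by omega)
      have h3 : ∀ s : ℕ, ∃ lam' : F, s ≤ t → ∀ S : Submodule K V, finrank K S = s →
          ∑ Y ∈ {Y : Submodule K V | finrank K Y = k ∧ S ≤ Y}, f Y = lam' := by
        intro s
        by_cases hs : s ≤ t
        · obtain ⟨lam', h'⟩ := exists_sum_ge_eq_of_le f hs
            (gaussBinom_ne_zero hq hm (by omega) (by omega)) hlam
          exact ⟨lam', fun _ => h'⟩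
        · exact ⟨0, fun h' => absurd h' hs⟩
      choose lam' hlam' using h3
      have h4 := sum_finrank_inf_eq f lam' hlam' hT hT' (k + t - j) (by omega)
      have h5 : ∀ x, x + j = k + t ↔ x = k + t - j := by omega
      simpa only [h5] using h4
    rw [sum_congr rfl h2] at h1
    exact add_left_cancel h1

end Designs

/-! ### Contractions of the dual -/

namespace QPolymatroid

section Dual

variable {K V F : Type*} [Field K] [Finite K] [AddCommGroup V] [Module K V]
  [FiniteDimensional K V] [Field F] {r : ℕ}

theorem ell_map_perp (M : QPolymatroid K V r) (p : Perp K V) (A : Submodule K V) :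
    M.ell (p.map A) = r * finrank K A - (M.dual p).rank A := by
  have h := M.rank_le_add (le_top : p.map A ≤ ⊤)
  have h1 := M.mono _ _ (le_top : p.map A ≤ ⊤)
  rw [finrank_top, ← p.finrank_map A, mul_add] at h
  simp only [ell, dual]
  omega

theorem dual_rank_eq_of_finrank_lt (M : QPolymatroid K V r) (p : Perp K V) {A : Submodule K V}
    (hA : finrank K A < M.minCocircuitDim p) : (M.dual p).rank A = r * finrank K A := by
  by_contra h
  obtain ⟨C, hCA, hC⟩ := exists_minimal_le_of_wellFoundedLT
    (fun A => ¬ (M.dual p).Indep A) A h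
  have h1 : M.minCocircuitDim p ≤ finrank K C := Nat.sInf_le ⟨C, hC, rfl⟩
  have h2 := Submodule.finrank_mono hCA
  omega

theorem weight_eq_zero (M : QPolymatroid K V r) (p : Perp K V) (θ : F) (X : Submodule K V)
    (h0 : 0 < finrank K X) (hX : finrank K X < M.minCocircuitDim p) : M.weight p θ X = 0 := by
  induction X using WellFoundedLT.induction with
  | ind X ih =>
    have hne : ⊥ ≠ X := by
      rintro rfl
      simp at h0
    have h := M.sum_weight_le p θ X
    rw [ell_map_perp, M.dual_rank_eq_of_finrank_lt p hX, Nat.sub_self, pow_zero,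
      sum_eq_add_of_mem ⊥ X (by simp) (by simp) hne, weight_bot] at h
    · simpa using h
    · intro Y hY ⟨hY0, hYX⟩
      have hlt : Y < X := lt_of_le_of_ne (mem_filter.1 hY).2 hYX
      exact ih Y hlt (Nat.pos_of_ne_zero fun h => hY0 (Submodule.finrank_eq_zero.1 h))
        ((Submodule.finrank_lt_finrank_of_lt hlt).trans hX)

variable (N : QPolymatroid K V r) (θ : F)

theorem sum_ge_pow_ell {t : ℕ} {T : Submodule K V} (hT : finrank K T = t) (p : Perp K (V ⧸ T))
    (u : ℕ) :
    ∑ A ∈ {A : Submodule K V | T ≤ A ∧ finrank K A = t + u}, θ ^ N.ell A =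
      ∑ j ∈ range (finrank K V - t + 1), Polynomial.aeval θ ((N.contract T).weightEnum p j) *
        (gaussBinom K (finrank K V - t - j) u : F) := by
  have h := (N.contract T).sum_pow_ell p θ u
  rw [Submodule.finrank_quotient, hT] at h
  rw [← h, ← sum_comap_mkQ T (fun A => finrank K A = t + u) (fun A => θ ^ N.ell A)]
  simp only [finrank_comap_mkQ, hT, add_right_inj, ell_contract]

/-- The coefficients `A_{N/T}(j;θ)` vanish for `1 ≤ j` outside a set `R` of at most `d - t` indices,
and the first `d - t` of the power sums that they determine are known, since spaces of dimension less
than `d` are independent. So these coefficients, and with them all the power sums, do not depend on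
`T`. -/
theorem sum_ge_pow_ell_eq {t d : ℕ}
    (hq : (Nat.card K : F) ≠ 0) (hm : ∀ i ∈ Icc 1 (finrank K V - t), qInt K F i ≠ 0)
    (hind : ∀ A : Submodule K V, finrank K A < d → N.rank A = r * finrank K A)
    (R : Finset ℕ) (hRm : R ⊆ Icc 1 (finrank K V - t)) (hRd : #R ≤ d - t)
    (p : ∀ T : Submodule K V, Perp K (V ⧸ T))
    (hzero : ∀ T : Submodule K V, finrank K T = t → ∀ j ∈ Icc 1 (finrank K V - t), j ∉ R →
      Polynomial.aeval θ ((N.contract T).weightEnum (p T) j) = 0)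
    {T T' : Submodule K V} (hT : finrank K T = t) (hT' : finrank K T' = t) (u : ℕ) :
    ∑ A ∈ {A : Submodule K V | T ≤ A ∧ finrank K A = t + u}, θ ^ N.ell A =
      ∑ A ∈ {A : Submodule K V | T' ≤ A ∧ finrank K A = t + u}, θ ^ N.ell A := by
  set δ : ℕ → F := fun j => Polynomial.aeval θ ((N.contract T).weightEnum (p T) j) -
    Polynomial.aeval θ ((N.contract T').weightEnum (p T') j) with hδ
  have hδ0 : ∀ j ∈ range (finrank K V - t + 1), j ∉ R → δ j = 0 := by
    intro j hj hjR
    rcases Nat.eq_zero_or_pos j with rfl | h0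
    · simp only [hδ, aeval_weightEnum_zero, sub_self]
    · have hj' : j ∈ Icc 1 (finrank K V - t) :=
        mem_Icc.2 ⟨h0, Nat.lt_succ_iff.1 (mem_range.1 hj)⟩
      simp only [hδ, hzero T hT j hj' hjR, hzero T' hT' j hj' hjR, sub_self]
  have hlow : ∀ T : Submodule K V, finrank K T = t → ∀ u < d - t,
      ∑ A ∈ {A : Submodule K V | T ≤ A ∧ finrank K A = t + u}, θ ^ N.ell A =
        gaussBinom K (finrank K V - t) u * θ ^ (N.rank ⊤ - r * (t + u)) := by
    intro T hT u hu
    have h1 := card_ge_finrank_eq T u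
    rw [hT] at h1
    rw [← h1, ← nsmul_eq_mul, ← sum_const]
    refine sum_congr rfl fun A hA => ?_
    obtain ⟨-, h2⟩ := (mem_filter.1 hA).2
    rw [ell, hind A (by omega), h2]
  have hδR : ∀ j ∈ R, δ j = 0 := by
    refine eq_zero_of_sum_gaussBinom_eq_zero hq hm R (fun j hj => (mem_Icc.1 (hRm hj)).2) δ ?_
    intro u hu
    have h1 := (hlow T hT u (by omega)).trans (hlow T' hT' u (by omega)).symm
    rw [N.sum_ge_pow_ell θ hT (p T), N.sum_ge_pow_ell θ hT' (p T'), ← sub_eq_zero,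
      ← sum_sub_distrib] at h1
    simp only [← sub_mul] at h1
    rw [← h1]
    refine sum_subset (fun j hj => ?_) fun j hj hjR => mul_eq_zero_of_left (hδ0 j hj hjR) _
    exact mem_range.2 (Nat.lt_succ_of_le (mem_Icc.1 (hRm hj)).2)
  rw [N.sum_ge_pow_ell θ hT (p T), N.sum_ge_pow_ell θ hT' (p T')]
  refine sum_congr rfl fun j hj => ?_
  have h1 : δ j = 0 := by
    by_cases hjR : j ∈ R
    · exact hδR j hjR
    · exact hδ0 j hj hjR
  rw [sub_eq_zero.1 h1]

/-- At `θ = 0` the power sums count spanning spaces. As at most `d - t` of the coefficients other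
than the leading one are nonzero, some spanning space has dimension at most `d`. -/
theorem rank_top_le_of_card_le {t d : ℕ} (htd : t < d)
    (hq : (Nat.card K : F) ≠ 0) (hm : ∀ i ∈ Icc 1 (finrank K V - t), qInt K F i ≠ 0)
    (R : Finset ℕ) (hRm : R ⊆ Icc 1 (finrank K V - t)) (hRd : #R ≤ d - t)
    {T : Submodule K V} (hT : finrank K T = t) (p : Perp K (V ⧸ T))
    (hzero : ∀ j ∈ Icc 1 (finrank K V - t), j ∉ R →
      Polynomial.aeval (0 : F) ((N.contract T).weightEnum p j) = 0) :
    N.rank ⊤ ≤ r * d := by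
  by_contra! hlt
  have hvan : ∀ u ≤ d - t,
      ∑ A ∈ {A : Submodule K V | T ≤ A ∧ finrank K A = t + u}, (0 : F) ^ N.ell A = 0 := by
    intro u hu
    refine sum_eq_zero fun A hA => zero_pow ?_
    obtain ⟨-, h2⟩ := (mem_filter.1 hA).2
    have h3 := N.rank_le A
    have h4 : r * finrank K A ≤ r * d := Nat.mul_le_mul_left r (by omega)
    rw [ell]
    omega
  have h0 : 0 ∉ R := fun h => by simpa using hRm h
  have h1 := eq_zero_of_sum_gaussBinom_eq_zero hq hm (insert 0 R)
    (fun j hj => by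
      rcases mem_insert.1 hj with rfl | hj
      · exact Nat.zero_le _
      · exact (mem_Icc.1 (hRm hj)).2)
    (fun j => Polynomial.aeval (0 : F) ((N.contract T).weightEnum p j)) (by
      intro u hu
      rw [card_insert_of_notMem h0] at hu
      refine Eq.trans ?_ (hvan u (by omega))
      rw [N.sum_ge_pow_ell 0 hT p]
      refine sum_subset (fun j hj => ?_) fun j hj hjR => ?_
      · rcases mem_insert.1 hj with rfl | hj
        · exact mem_range.2 (Nat.succ_pos _)
        · exact mem_range.2 (Nat.lt_succ_of_le (mem_Icc.1 (hRm hj)).2)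
      · rw [mem_insert, not_or] at hjR
        have := mem_range.1 hj
        exact mul_eq_zero_of_left (hzero j (mem_Icc.2 ⟨by omega, by omega⟩) hjR.2) _)
    0 (mem_insert_self _ _)
  simp only [aeval_weightEnum_zero] at h1
  exact one_ne_zero h1

/-- The MacWilliams-type relation between the summatory functions of the weights of a polymatroid and
of its dual. For `θ ≠ 0` they differ by a power of `θ` which depends on the dimension only. For
`θ = 0` they are the indicators of independent and of spanning spaces; these can be compared in each
dimension because all spaces of dimension less than `d` are independent and the rank is at most
`r d`. -/
theorem exists_pow_sub_rank_eq {d : ℕ}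
    (hind : ∀ A : Submodule K V, finrank K A < d → N.rank A = r * finrank K A)
    (htop : θ = 0 → N.rank ⊤ ≤ r * d) :
    ∃ c e : ℕ → F, ∀ A : Submodule K V,
      θ ^ (r * finrank K A - N.rank A) = c (finrank K A) * θ ^ N.ell A + e (finrank K A) := by
  rcases Nat.eq_zero_or_pos r with rfl | hr
  · exact ⟨fun _ => 0, fun _ => 1, fun A => by simp⟩
  by_cases hθ : θ = 0
  · subst hθ
    have htop := htop rfl
    refine ⟨fun k => if k = d ∧ N.rank ⊤ = r * d then 1 else 0, fun k => if k < d then 1 else 0,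
      fun A => ?_⟩
    have hA := N.mono A ⊤ le_top
    rcases lt_trichotomy (finrank K A) d with h | h | h
    · simp [hind A h, h, h.ne]
    · by_cases h' : N.rank ⊤ = r * d
      · simp [h, h', ell]
      · simp only [h, h', and_false, if_false, lt_irrefl, zero_mul, add_zero]
        exact zero_pow (by omega)
    · have h1 : r * d < r * finrank K A := Nat.mul_lt_mul_of_pos_left h hr
      simp only [h.ne', h.not_gt, false_and, if_false, zero_mul, add_zero]
      exact zero_pow (by omega)
  · refine ⟨fun k => θ ^ (r * k) / θ ^ N.rank ⊤, fun _ => 0, fun A => ?_⟩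
    have hA := N.mono A ⊤ le_top
    rw [add_zero, div_mul_eq_mul_div, eq_div_iff (pow_ne_zero _ hθ), ← pow_add, ← pow_add, ell]
    congr 1
    have := N.rank_le A
    omega

end Dual

end QPolymatroid

end

end QPoly

theorem corollary5p6 {K E F : Type*} [Field K] [Finite K] [AddCommGroup E] [Module K E]
    [FiniteDimensional K E] [Field F] {r : ℕ}
    (M : QPoly.QPolymatroid K E r)
    -- the fixed anti-isomorphisms of the subspace lattices of `E` and of its quotients
    (perp : QPoly.Perp K E) (perpQ : ∀ T : Submodule K E, QPoly.Perp K (E ⧸ T))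
    (θ : F) (hθ : ∀ s ∈ Finset.Icc 1 r, θ ^ s ≠ 1)
    (t : ℕ) (ht : 0 < t) (htd : t < M.minCocircuitDim perp)
    -- `q` and the `q`-integers `1 + q + ⋯ + q^(i-1)`, `1 ≤ i ≤ n - t`, are nonzero in `F`
    (hq : (Nat.card K : F) ≠ 0)
    (hqint : ∀ i ∈ Finset.Icc 1 (Module.finrank K E - t),
      ∑ k ∈ Finset.range i, (Nat.card K : F) ^ k ≠ 0)
    (hR : (M.dualWeights perp t θ).card ≤ M.minCocircuitDim perp - t)
    (hzero : ∀ T : Submodule K E, Module.finrank K T = t →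
      ∀ j ≤ Module.finrank K E - t,
        Polynomial.aeval θ ((M.dual perp).weightEnum perp j) = 0 →
        Polynomial.aeval θ (((M.dual perp).contract T).weightEnum (perpQ T) j) = 0) :
    ∀ j ∈ Finset.Icc (M.minCocircuitDim perp) (Module.finrank K E - t),
      ∃ lam : F, QPoly.IsWeightedDesign t j lam (M.blocks perp j θ)
        (fun X => M.weight perp θ (X : Submodule K E)) := by
  classical
  intro j hj
  obtain ⟨hdj, hjm⟩ := Finset.mem_Icc.1 hj
  have hind : ∀ A : Submodule K E, Module.finrank K A < M.minCocircuitDim perp →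
      (M.dual perp).rank A = r * Module.finrank K A :=
    fun A hA => M.dual_rank_eq_of_finrank_lt perp hA
  have hRm : M.dualWeights perp t θ ⊆ Finset.Icc 1 (Module.finrank K E - t) :=
    Finset.filter_subset _ _
  have hz : ∀ T : Submodule K E, Module.finrank K T = t →
      ∀ i ∈ Finset.Icc 1 (Module.finrank K E - t), i ∉ M.dualWeights perp t θ →
        Polynomial.aeval θ (((M.dual perp).contract T).weightEnum (perpQ T) i) = 0 := by
    intro T hT i hi hiR
    refine hzero T hT i (Finset.mem_Icc.1 hi).2 ?_
    by_contra h
    exact hiR (Finset.mem_filter.2 ⟨hi, h⟩)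
  obtain ⟨lam, hlam⟩ := QPoly.sum_ge_eq_of_sum_finrank_sup_eq (M.weight perp θ) htd
    (Nat.sub_le _ t) hq hqint (M.weight_eq_zero perp θ) (fun T T' hT hT' =>
      QPoly.sum_finrank_sup_eq_of_sum_ge_eq (M.weight perp θ) hT hT' fun i hi => by
        have htop : θ = 0 → (M.dual perp).rank ⊤ ≤ r * M.minCocircuitDim perp := by
          rintro rfl
          exact (M.dual perp).rank_top_le_of_card_le htd hq hqint _ hRm hR hT (perpQ T) (hz T hT)
        obtain ⟨c, e, hce⟩ := (M.dual perp).exists_pow_sub_rank_eq θ hind htop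
        have hsum : ∀ S : Submodule K E, Module.finrank K S = t →
            ∑ A ∈ {A : Submodule K E | S ≤ A ∧ Module.finrank K A = i},
              ∑ Y ∈ {Y | Y ≤ A}, M.weight perp θ Y =
            c i * ∑ A ∈ {A : Submodule K E | S ≤ A ∧ Module.finrank K A = i},
              θ ^ (M.dual perp).ell A +
              QPoly.gaussBinom K (Module.finrank K E - t) (i - t) * e i := by
          intro S hS
          have h1 := QPoly.card_ge_finrank_eq S (i - t)
          rw [hS, Nat.add_sub_cancel' (Finset.mem_Icc.1 hi).1] at h1
          rw [← h1, ← nsmul_eq_mul, ← Finset.sum_const, Finset.mul_sum, ← Finset.sum_add_distrib]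
          refine Finset.sum_congr rfl fun A hA => ?_
          rw [M.sum_weight_le perp θ A, M.ell_map_perp, hce A, (Finset.mem_filter.1 hA).2.2]
        have h2 := (M.dual perp).sum_ge_pow_ell_eq θ hq hqint hind _ hRm hR perpQ hz hT hT' (i - t)
        rw [Nat.add_sub_cancel' (Finset.mem_Icc.1 hi).1] at h2
        rw [hsum T hT, hsum T' hT', h2])
    j (by omega) hjm
  refine ⟨lam, ht, by omega, fun X hX => hX.1, fun T hT => ?_⟩
  rw [← hlam T hT]
  -- spaces of weight zero are not blocks, and contribute nothing to the sum
  refine Finset.sum_bij_ne_zero (fun X _ _ => (X : Submodule K E)) ?_ ?_ ?_ ?_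
  · intro X hX _
    exact Finset.mem_filter.2 ⟨Finset.mem_univ _, X.2.1, (Finset.mem_filter.1 hX).2⟩
  · intro X _ _ Y _ _ h
    exact Subtype.ext h
  · intro Y hY hne
    obtain ⟨hYj, hTY⟩ := (Finset.mem_filter.1 hY).2
    exact ⟨⟨Y, hYj, hne⟩, Finset.mem_filter.2 ⟨Finset.mem_univ _, hTY⟩, hne, rfl⟩
  · intros
    rfl
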